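/- Let $d\ge 1$ be an integer and let $\mathcal H$ be the upper half-plane. Let $V_2$ be the complex vector space of even functions $f:(\mathbb Z/2\mathbb Z)^d\to\mathbb C$ (i.e. $f(-x)=f(x)$; over $\mathbb Z/2\mathbb Z$ this holds for every function), and for $f\in V_2$ let $$\theta_f(\tau)=\sum_{x\in\mathbb Z^d} f(x \bmod 2)\,e^{2\pi i (x_1^2+\cdots+x_d^2)\tau},\qquad \tau\in\mathcal H .$$ Let $\Gamma_1(4)=\{\begin{pmatrix}a&b\\c&e\end{pmatrix}\in \mathrm{SL}_2(\mathbb Z): a\equiv e\equiv 1,\ c\equiv 0 \pmod 4\}$. For $g=\begin{pmatrix}a&b\\c&e\end{pmatrix}\in\Gamma_1(4)$ and $\tau\in\mathcal H$ put $$h(g,\tau)=\varepsilon_e^{-1}\left(\frac{c}{e}\right)\sqrt{c\tau+e},$$ with the principal branch of the square root, $\varepsilon_e=1$ if $e\equiv 1 \pmod 4$ and $\varepsilon_e=i$ if $e\equiv 3\pmod 4$ (so $\varepsilon_e=1$ on $\Gamma_1(4)$), and $\left(\frac{c}{e}\right)$ the extended quadratic symbol: the Jacobi symbol for $e>0$,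 $\left(\frac{c}{e}\right)=\frac{c}{|c|}\left(\frac{c}{-e}\right)$ for $e<0$, $c\ne0$, and $\left(\frac{0}{e}\right)=1$ if $e=\pm1$ and $0$ otherwise. For $\psi:\mathcal H\to\mathbb C$ define the weight $\tfrac d2$ operator $$([\tilde g]_{d/2}\cdot\psi)(\tau)=h(g^{-1},\tau)^{-d}\,\psi(g^{-1}\cdot\tau).$$ Let $\gamma=\begin{pmatrix}0&1\\-4&0\end{pmatrix}$, let $\mu:\Gamma_1(4)\to\Gamma_1(4)$, $\mu(g)=\gamma g\gamma^{-1}$, let $\omega_2:\mathrm{SL}_2(\mathbb Z)\to \mathrm{SL}_2(\mathbb Z/4\mathbb Z)$ be reduction modulo $4$, and let $U_4=\{\begin{pmatrix}1&i\\0&1\end{pmatrix}: i\in\mathbb Z/4\mathbb Z\}\cong\mathbb Z/4\mathbb Z$, which contains $\omega_2(\Gamma_1(4))$. **Theorem.** There exist a linear representation $\pi_2:\Gamma_1(4)\to \mathrm{GL}(V_2)$ and a linear representation $\rho_2:U_4\to\mathrm{GL}(V_2)$ such that $\pi_2=\rho_2\circ\omega_2\circ\mu$ and, for all $g\in\Gamma_1(4)$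 and all $f\in V_2$, $$[\tilde g]_{d/2}\cdot\theta_f=\theta_{\pi_2(g)f}.$$ -/

import Mathlib

open scoped UpperHalfPlane MatrixGroups

noncomputable section

namespace WeightedTheta

/-! ### Weighted theta functions -/

/-- The space of even functions `(ℤ/N)^d → ℂ`. -/
def evenFunctions (N d : ℕ) : Submodule ℂ ((Fin d → ZMod N) → ℂ) where
  carrier := {f | ∀ x, f (-x) = f x}
  add_mem' := by
    intro f g hf hg x
    simp only [Pi.add_apply, hf x, hg x]
  zero_mem' := by
    intro x
    rfl
  smul_mem' := by
    intro c f hf x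
    simp only [Pi.smul_apply, hf x]

/-- The standard quadratic form `Q(x,x) = x₁² + ⋯ + x_d²` on `ℤ^d`. -/
def quad {d : ℕ} (x : Fin d → ℤ) : ℤ := ∑ i, x i ^ 2

/-- The reduction `ℤ^d → (ℤ/N)^d`. -/
def reduce (N : ℕ) {d : ℕ} (x : Fin d → ℤ) : Fin d → ZMod N := fun i => (x i : ZMod N)

/-- The general term of the series defining the weighted theta function. -/
def thetaTerm {N d : ℕ} (f : (Fin d → ZMod N) → ℂ) (τ : ℍ) (x : Fin d → ℤ) : ℂ :=
  f (reduce N x) * Complex.exp (2 * Real.pi * Complex.I * (quad x : ℂ) * (τ : ℂ))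

/-- The weighted theta function
`θ_f(τ) = ∑_{x ∈ ℤ^d} f(x mod N) exp(2 π i Q(x,x) τ)`. -/
def theta {N d : ℕ} (f : (Fin d → ZMod N) → ℂ) : ℍ → ℂ :=
  fun τ => ∑' x : Fin d → ℤ, thetaTerm f τ x

theorem summable_pi_prod {d : ℕ} (u : ℤ → ℝ) (h0 : ∀ n, 0 ≤ u n) (hu : Summable u) :
    Summable (fun x : Fin d → ℤ => ∏ i, u (x i)) := by
  induction d with
  | zero => exact (hasSum_fintype _).summable
  | succ d ih =>
    rw [← (Fin.consEquiv (fun _ : Fin (d + 1) => ℤ)).summable_iff]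
    have := hu.mul_of_nonneg ih h0 (fun x => Finset.prod_nonneg fun i _ => h0 (x i))
    refine this.congr fun p => ?_
    simp [Fin.prod_univ_succ, Fin.consEquiv]

/-- The series defining `theta` converges absolutely for every `f` and every `τ`. -/
theorem summable_thetaTerm {N d : ℕ} [NeZero N] (f : (Fin d → ZMod N) → ℂ) (τ : ℍ) :
    Summable (thetaTerm f τ) := by
  have h2 : 0 < (2 * (τ : ℂ)).im := by
    simpa using τ.im_pos
  have hs : Summable (fun n : ℤ =>
      ‖Complex.exp (Real.pi * Complex.I * (n : ℂ) ^ 2 * (2 * (τ : ℂ)))‖) := by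
    refine (((summable_jacobiTheta₂_term_iff 0 _).2 h2).norm).congr fun n => ?_
    simp [jacobiTheta₂_term]
  have hp := summable_pi_prod (d := d) _ (fun _ => norm_nonneg _) hs
  refine Summable.of_norm_bounded (hp.mul_left (∑ y, ‖f y‖)) fun x => ?_
  rw [thetaTerm, norm_mul]
  refine mul_le_mul (Finset.single_le_sum (f := fun y => ‖f y‖)
    (fun y _ => norm_nonneg _) (Finset.mem_univ _)) (le_of_eq ?_) (norm_nonneg _)
    (Finset.sum_nonneg fun y _ => norm_nonneg _)
  rw [← norm_prod, ← Complex.exp_sum]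
  congr 2
  simp only [quad, Int.cast_sum, Int.cast_pow, Finset.mul_sum, Finset.sum_mul]
  exact Finset.sum_congr rfl fun i _ => by ring

/-! ### The theta multiplier and the action in half-integral weight -/

/-- The extended quadratic symbol `(c/d)`, for `d` an odd integer: the Jacobi symbol for `d > 0`;
for `d < 0` and `c ≠ 0` it is `sign c` times the symbol of `c` over `|d|`; and `(0/±1) = 1`, `(0/d) = 0` for other `d`. -/
def extSymbol (c d : ℤ) : ℤ :=
  if c = 0 then (if d = 1 ∨ d = -1 then 1 else 0)
  else if d < 0 then c.sign * jacobiSym c d.natAbs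
  else jacobiSym c d.natAbs

/-- `ε_d`, for `d` an odd integer: `1` if `d ≡ 1 mod 4` and `i` if `d ≡ 3 mod 4`. -/
def eps (d : ℤ) : ℂ := if d % 4 = 1 then 1 else Complex.I

/-- The theta multiplier `h(g,τ) = ε_d⁻¹ (c/d) √(cτ+d)` (principal branch of the square root) for
`g = [a, b; c, d]` in `Γ₀(4)`. -/
def thetaMult (g : SL(2, ℤ)) (τ : ℍ) : ℂ :=
  (eps (g 1 1))⁻¹ * (extSymbol (g 1 0) (g 1 1) : ℂ) *
    Complex.sqrt ((g 1 0 : ℂ) * (τ : ℂ) + (g 1 1 : ℂ))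

/-- The left operator of weight `m / 2` attached to the lift of `g ∈ Γ₁(4)` to the metaplectic
group: `ψ ↦ h(g⁻¹,τ)^(-m) ψ(g⁻¹ • τ)`. -/
def slashHalf (m : ℤ) (g : CongruenceSubgroup.Gamma1 4) (ψ : ℍ → ℂ) : ℍ → ℂ :=
  fun τ => thetaMult ((g⁻¹ : CongruenceSubgroup.Gamma1 4) : SL(2, ℤ)) τ ^ (-m) *
    ψ (((g⁻¹ : CongruenceSubgroup.Gamma1 4) : SL(2, ℤ)) • τ)

/-! ### Conjugation by `γ` and reduction modulo `4` -/

/-- The matrix `γ = [0, 1; -4, 0]`. -/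
def gammaMat : GL (Fin 2) ℚ :=
  Matrix.GeneralLinearGroup.mkOfDetNeZero !![0, 1; -4, 0] (by simp [Matrix.det_fin_two])

theorem four_dvd (g : CongruenceSubgroup.Gamma1 4) : (4 : ℤ) ∣ (g : SL(2, ℤ)) 1 0 :=
  (ZMod.intCast_zmod_eq_zero_iff_dvd _ 4).1 ((CongruenceSubgroup.Gamma1_mem 4 _).1 g.2).2.2

/-- Conjugation by `γ` on matrices of `Γ₁(4)`: `[a, b; c, d] ↦ [d, -c/4; -4b, a]`
(the division is exact); see `conjGamma_spec`. -/
def conjGammaFun (g : CongruenceSubgroup.Gamma1 4) : CongruenceSubgroup.Gamma1 4 :=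
  ⟨⟨!![(g : SL(2, ℤ)) 1 1, -((g : SL(2, ℤ)) 1 0 / 4);
      -4 * (g : SL(2, ℤ)) 0 1, (g : SL(2, ℤ)) 0 0], by
      obtain ⟨k, hk⟩ := four_dvd g
      have hdet := Matrix.det_fin_two (g : SL(2, ℤ)).1
      rw [(g : SL(2, ℤ)).2] at hdet
      rw [Matrix.det_fin_two_of, hk, Int.mul_ediv_cancel_left _ (by norm_num)]
      rw [hk] at hdet
      linarith⟩, by
    obtain ⟨h1, h2, h3⟩ := (CongruenceSubgroup.Gamma1_mem 4 _).1 g.2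
    refine (CongruenceSubgroup.Gamma1_mem 4 _).2 ⟨?_, ?_, ?_⟩
    · simpa using h2
    · simpa using h1
    · have h4 : (4 : ZMod 4) = 0 := rfl
      simp [h4]⟩

/-- `conjGammaFun g = γ g γ⁻¹` in `GL₂(ℚ)`. -/
theorem conjGammaFun_spec (g : CongruenceSubgroup.Gamma1 4) :
    (((conjGammaFun g : CongruenceSubgroup.Gamma1 4) : SL(2, ℤ)) : GL (Fin 2) ℚ) =
      gammaMat * ((g : SL(2, ℤ)) : GL (Fin 2) ℚ) * gammaMat⁻¹ := by
  obtain ⟨k, hk⟩ := four_dvd g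
  rw [eq_mul_inv_iff_mul_eq]
  apply Units.ext
  have hm : (((conjGammaFun g : CongruenceSubgroup.Gamma1 4) : SL(2, ℤ)) : GL (Fin 2) ℚ).1 =
      !![((g : SL(2, ℤ)) 1 1 : ℚ), -(k : ℚ); -4 * ((g : SL(2, ℤ)) 0 1 : ℚ),
        ((g : SL(2, ℤ)) 0 0 : ℚ)] := by
    ext i j
    change ((((conjGammaFun g).1.1 i j : ℤ)) : ℚ) = _
    fin_cases i <;> fin_cases j <;> simp [conjGammaFun, hk]
  have hg : ((g : SL(2, ℤ)) : GL (Fin 2) ℚ).1 =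
      !![((g : SL(2, ℤ)) 0 0 : ℚ), ((g : SL(2, ℤ)) 0 1 : ℚ); 4 * (k : ℚ),
        ((g : SL(2, ℤ)) 1 1 : ℚ)] := by
    ext i j
    change (((g : SL(2, ℤ)).1 i j : ℤ) : ℚ) = _
    fin_cases i <;> fin_cases j <;> simp [hk]
  change _ * gammaMat.1 = gammaMat.1 * _
  rw [hm, hg]
  change _ * !![(0 : ℚ), 1; -4, 0] = !![(0 : ℚ), 1; -4, 0] * _
  simp [mul_comm]

theorem coe_injective : Function.Injective
    (fun g : CongruenceSubgroup.Gamma1 4 => ((g : SL(2, ℤ)) : GL (Fin 2) ℚ)) := by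
  intro g g' h
  ext i j
  have := congrArg (fun M : GL (Fin 2) ℚ => M.1 i j) h
  simpa using this

/-- The homomorphism `μ : Γ₁(4) → Γ₁(4)`, `g ↦ γ g γ⁻¹`. -/
def conjGamma : CongruenceSubgroup.Gamma1 4 →* CongruenceSubgroup.Gamma1 4 :=
  MonoidHom.mk' conjGammaFun fun g g' => coe_injective <| by
    have := conjGammaFun_spec
    simp only [Subgroup.coe_mul, map_mul] at this ⊢
    simp [this, mul_assoc]

theorem conjGamma_spec (g : CongruenceSubgroup.Gamma1 4) :
    (((conjGamma g : CongruenceSubgroup.Gamma1 4) : SL(2, ℤ)) : GL (Fin 2) ℚ) =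
      gammaMat * ((g : SL(2, ℤ)) : GL (Fin 2) ℚ) * gammaMat⁻¹ :=
  conjGammaFun_spec g

/-- The homomorphism `ℤ/4 → SL₂(ℤ/4)`, `i ↦ [1, i; 0, 1]`. -/
def unipotent : Multiplicative (ZMod 4) →* SL(2, ZMod 4) :=
  MonoidHom.mk' (fun i => ⟨!![1, i.toAdd; 0, 1], by simp [Matrix.det_fin_two]⟩) fun i j =>
    Subtype.ext <| by
      change _ = !![1, i.toAdd; 0, 1] * !![1, j.toAdd; 0, 1]
      simp [add_comm]

/-- The group `U₄ = {[1, i; 0, 1] : i ∈ ℤ/4} ⊆ SL₂(ℤ/4)`. -/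
def U4 : Subgroup SL(2, ZMod 4) := unipotent.range

theorem mem_U4 {A : SL(2, ZMod 4)} (h1 : A 0 0 = 1) (h2 : A 1 1 = 1) (h3 : A 1 0 = 0) :
    A ∈ U4 := by
  refine ⟨Multiplicative.ofAdd (A 0 1), ?_⟩
  apply Subtype.ext
  change !![1, A 0 1; 0, 1] = A.1
  rw [Matrix.eta_fin_two A.1, h1, h2, h3]
  rfl

/-- `U₄` is isomorphic to the cyclic group `ℤ/4`. -/
def U4Equiv : Multiplicative (ZMod 4) ≃* U4 :=
  MonoidHom.ofInjective (f := unipotent) fun i j h => by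
    exact congrArg (fun A : SL(2, ZMod 4) => A 0 1) h

/-- Entrywise reduction modulo `4`, `ω : SL₂(ℤ) → SL₂(ℤ/4)`, restricted to `Γ₁(4)`; it takes values
in `U₄`. -/
def reduceU4 : CongruenceSubgroup.Gamma1 4 →* U4 :=
  ((Matrix.SpecialLinearGroup.map (Int.castRingHom (ZMod 4))).comp
    (CongruenceSubgroup.Gamma1 4).subtype).codRestrict U4 fun g => by
      obtain ⟨h1, h2, h3⟩ := (CongruenceSubgroup.Gamma1_mem 4 _).1 g.2
      exact mem_U4 (by simpa using h1) (by simpa using h2) (by simpa using h3)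

end WeightedTheta

end

open scoped UpperHalfPlane MatrixGroups

noncomputable section

namespace WeightedTheta

/-! ### The extended quadratic symbol -/

/-! The group `Γ₁(4)` is generated by T = [1, 1; 0, 1] and U = [1, 0; 4, 1] (`closure_genT_genU`),
so it suffices to treat generators once both sides are known to be actions. The right side is one by
construction. For the left side, h must be an exact cocycle, sign included (`thetaMult_mul`); this
too is reduced to right multiplication by T and U, where quadratic reciprocity and the branch of the
square root decide the sign.

The functions θ_f diagonalise in the basis of characters of (ℤ/2)^d. The theta function of a
character is a product of Jacobi thetas with z ∈ {0, 1/2} and modulus 2τ (`theta_signChar`). T fixes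
each of them. Conjugating U by the inversion turns it into a translation by 2, so U multiplies each
factor by √(4τ+1), and by a further -i when z = 1/2 (`jacobiTheta₂_genU_smul`). Hence U has
eigenvalue (-i)^weight after division by h^d. Since μ(T) ≡ 1 and μ(U) = [1, -1; 0, 1], these
eigenvalues define ρ₂ on U₄. -/

theorem jacobiSym_congr_right {c : ℤ} (hc : 4 ∣ c) {m n : ℕ} (hm : Odd m) (hn : Odd n)
    (h : (m : ℤ) ≡ n [ZMOD c]) : jacobiSym c m = jacobiSym c n := by
  obtain ⟨k, rfl⟩ := hc
  have h' : m % (4 * k.natAbs) = n % (4 * k.natAbs) := by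
    have h1 : (m : ℤ) ≡ n [ZMOD ((4 * k.natAbs : ℕ) : ℤ)] := by
      refine Int.modEq_iff_dvd.2 (dvd_trans ?_ (Int.modEq_iff_dvd.1 h))
      rw [Int.natCast_dvd, Int.natAbs_mul]
      rfl
    exact (Int.natCast_modEq_iff).1 h1
  -- The factor 4 is a square, and by reciprocity (k/m) depends only on m modulo 4|k| = |c|.
  rw [jacobiSym.mul_left, jacobiSym.mul_left, jacobiSym.at_four hm, jacobiSym.at_four hn,
    jacobiSym.mod_right k hm, jacobiSym.mod_right k hn, h']

/-- Since |c| ≡ 1 modulo |c| - 1, only the sign of c matters, and -1 has symbol -1 because |c| - 1 ≡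
3 mod 4. -/
theorem jacobiSym_natAbs_sub_one {c : ℤ} (hc : 4 ∣ c) (hc0 : c ≠ 0) :
    jacobiSym c (c.natAbs - 1) = c.sign := by
  have h4 : (4 : ℕ) ∣ c.natAbs := Int.natCast_dvd.1 (by exact_mod_cast hc)
  have hpos : 0 < c.natAbs := Int.natAbs_pos.2 hc0
  have hodd : Odd (c.natAbs - 1) := by
    rw [Nat.odd_iff]; omega
  have habs : jacobiSym (c.natAbs : ℤ) (c.natAbs - 1) = 1 := by
    rw [jacobiSym.mod_left' (a₂ := 1), jacobiSym.one_left]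
    exact (Int.modEq_iff_dvd.2 ⟨-1, by
      rw [show ((c.natAbs - 1 : ℕ) : ℤ) = (c.natAbs : ℤ) - 1 by omega]; ring⟩ :
      (c.natAbs : ℤ) ≡ 1 [ZMOD ((c.natAbs - 1 : ℕ) : ℤ)])
  rcases lt_or_gt_of_ne hc0 with h | h
  · have hc' : c = -(c.natAbs : ℤ) := by omega
    rw [Int.sign_eq_neg_one_of_neg h]
    nth_rewrite 1 [hc']
    rw [jacobiSym.neg _ hodd, habs, ZMod.χ₄_nat_three_mod_four (by omega)]
    rfl
  · have hc' : c = (c.natAbs : ℤ) := by omega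
    rw [Int.sign_eq_one_of_pos h]
    nth_rewrite 1 [hc']
    exact habs

theorem jacobiSym_neg_right {c : ℤ} (hc : 4 ∣ c) (hc0 : c ≠ 0) {m n : ℕ} (hm : Odd m) (hn : Odd n)
    (h : (n : ℤ) ≡ -m [ZMOD c]) :
    jacobiSym c n = c.sign * jacobiSym c m := by
  have h4 : (4 : ℕ) ∣ c.natAbs := Int.natCast_dvd.1 (by exact_mod_cast hc)
  have hpos : 0 < c.natAbs := Int.natAbs_pos.2 hc0
  have hodd : Odd (c.natAbs - 1) := by
    rw [Nat.odd_iff]; omega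
  have hcast : ((c.natAbs - 1 : ℕ) : ℤ) = (c.natAbs : ℤ) - 1 := by
    push_cast [Nat.cast_sub (show 1 ≤ c.natAbs from hpos)]; ring
  have hne : c.natAbs - 1 ≠ 0 := by omega
  -- Modulo c, -m ≡ (|c| - 1)m with |c| - 1 a positive odd number, so multiplicativity in the lower
  -- entry applies.
  rw [← jacobiSym_natAbs_sub_one hc hc0, ← jacobiSym.mul_right' c hne hm.pos.ne']
  refine jacobiSym_congr_right hc hn (hodd.mul hm) (h.trans ?_)
  rw [Nat.cast_mul, hcast]
  refine Int.modEq_iff_dvd.2 ?_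
  have : c ∣ (c.natAbs : ℤ) := Int.dvd_natAbs_self
  have h' := this.mul_right (m : ℤ)
  rwa [show ((c.natAbs : ℤ) - 1) * m - -m = c.natAbs * m by ring]

theorem natAbs_odd {c d : ℤ} (hc : 4 ∣ c) (hcd : IsCoprime c d) : Odd d.natAbs := by
  rw [Int.natAbs_odd, ← Int.not_even_iff_odd]
  intro hd
  have h2 : IsUnit (2 : ℤ) :=
    hcd.isUnit_of_dvd' (dvd_trans (by norm_num) hc) hd.two_dvd
  exact absurd (Int.isUnit_iff.1 h2) (by norm_num)

/-- The symbol `(c/d)` depends only on `d` modulo `c`, for `4 ∣ c`. -/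
theorem extSymbol_add_self {c d : ℤ} (hc : 4 ∣ c) (hcd : IsCoprime c d) :
    extSymbol c (c + d) = extSymbol c d := by
  rcases eq_or_ne c 0 with rfl | hc0
  · simp
  have hcd' : IsCoprime c (c + d) := by
    have := hcd.add_mul_left_right 1
    rwa [mul_one, add_comm] at this
  have h1 := natAbs_odd hc hcd
  have h2 := natAbs_odd hc hcd'
  have hs : c.sign * c.sign = 1 := by
    rcases lt_or_gt_of_ne hc0 with h | h
    · rw [Int.sign_eq_neg_one_of_neg h]; rfl
    · rw [Int.sign_eq_one_of_pos h]; rfl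
  simp only [extSymbol, hc0, if_false]
  -- If c + d and d have the same sign, their absolute values agree up to sign of the shift modulo
  -- c; otherwise |c + d| ≡ -|d|, and the factor `c.sign` compensates.
  split_ifs with ha hb hb
  · rw [jacobiSym_congr_right hc h2 h1]
    exact Int.modEq_iff_dvd.2 ⟨1, by omega⟩
  · rw [jacobiSym_neg_right hc hc0 h1 h2, ← mul_assoc, hs, one_mul]
    exact Int.modEq_iff_dvd.2 ⟨1, by omega⟩
  · rw [jacobiSym_neg_right hc hc0 h1 h2]
    exact Int.modEq_iff_dvd.2 ⟨-1, by omega⟩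
  · rw [jacobiSym_congr_right hc h2 h1]
    exact Int.modEq_iff_dvd.2 ⟨-1, by omega⟩

/-! ### Euclidean generation of `Γ₁(4)` -/

/-- The translation `[1, 1; 0, 1]`. -/
def genT : CongruenceSubgroup.Gamma1 4 :=
  ⟨⟨!![1, 1; 0, 1], by simp [Matrix.det_fin_two]⟩,
    (CongruenceSubgroup.Gamma1_mem 4 _).2 ⟨by simp, by simp, by simp⟩⟩

/-- The matrix `[1, 0; 4, 1]`. -/
def genU : CongruenceSubgroup.Gamma1 4 :=
  ⟨⟨!![1, 0; 4, 1], by simp [Matrix.det_fin_two]⟩,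
    (CongruenceSubgroup.Gamma1_mem 4 _).2 ⟨by simp, by simp, by
      have h4 : (4 : ZMod 4) = 0 := rfl
      simp [h4]⟩⟩

theorem mul_bottom (g h : CongruenceSubgroup.Gamma1 4) (j : Fin 2) :
    (g * h).1 1 j = g.1 1 0 * h.1 0 j + g.1 1 1 * h.1 1 j := by
  change (g.1.1 * h.1.1) 1 j = _
  rw [Matrix.mul_apply, Fin.sum_univ_two]

theorem mul_genT_bottom (g : CongruenceSubgroup.Gamma1 4) :
    ((g * genT).1 1 0 = g.1 1 0) ∧ ((g * genT).1 1 1 = g.1 1 0 + g.1 1 1) := by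
  rw [mul_bottom, mul_bottom]
  change g.1 1 0 * 1 + g.1 1 1 * 0 = _ ∧ g.1 1 0 * 1 + g.1 1 1 * 1 = _
  constructor <;> ring

theorem mul_genU_bottom (g : CongruenceSubgroup.Gamma1 4) :
    ((g * genU).1 1 0 = g.1 1 0 + 4 * g.1 1 1) ∧ ((g * genU).1 1 1 = g.1 1 1) := by
  rw [mul_bottom, mul_bottom]
  change g.1 1 0 * 1 + g.1 1 1 * 4 = _ ∧ g.1 1 0 * 0 + g.1 1 1 * 1 = _
  constructor <;> ring

theorem mul_genT_inv_bottom (g : CongruenceSubgroup.Gamma1 4) :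
    ((g * genT⁻¹).1 1 0 = g.1 1 0) ∧ ((g * genT⁻¹).1 1 1 = g.1 1 1 - g.1 1 0) := by
  obtain ⟨h1, h2⟩ := mul_genT_bottom (g * genT⁻¹)
  rw [inv_mul_cancel_right] at h1 h2
  exact ⟨h1.symm, by omega⟩

theorem mul_genU_inv_bottom (g : CongruenceSubgroup.Gamma1 4) :
    ((g * genU⁻¹).1 1 0 = g.1 1 0 - 4 * g.1 1 1) ∧ ((g * genU⁻¹).1 1 1 = g.1 1 1) := by
  obtain ⟨h1, h2⟩ := mul_genU_bottom (g * genU⁻¹)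
  rw [inv_mul_cancel_right] at h1 h2
  exact ⟨by omega, h2.symm⟩

theorem four_dvd_sub_one (g : CongruenceSubgroup.Gamma1 4) : (4 : ℤ) ∣ g.1 1 1 - 1 :=
  (ZMod.intCast_zmod_eq_zero_iff_dvd _ 4).1 <| by
    have := ((CongruenceSubgroup.Gamma1_mem 4 _).1 g.2).2.1
    push_cast
    rw [this, sub_self]

theorem four_dvd_sub_one' (g : CongruenceSubgroup.Gamma1 4) : (4 : ℤ) ∣ g.1 0 0 - 1 :=
  (ZMod.intCast_zmod_eq_zero_iff_dvd _ 4).1 <| by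
    have := ((CongruenceSubgroup.Gamma1_mem 4 _).1 g.2).1
    push_cast
    rw [this, sub_self]

theorem genT_pow_apply (n : ℕ) : (genT ^ n).1.1 = !![1, (n : ℤ); 0, 1] := by
  induction n with
  | zero => simp [Matrix.one_fin_two]
  | succ n ih =>
    rw [pow_succ]
    change (genT ^ n).1.1 * !![1, 1; 0, 1] = _
    rw [ih]
    simp [add_comm]

theorem exists_eq_genT_zpow {g : CongruenceSubgroup.Gamma1 4} (hc : g.1 1 0 = 0) :
    ∃ n : ℤ, g = genT ^ n := by
  have hdet := Matrix.det_fin_two g.1.1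
  rw [g.1.2] at hdet
  have hd := four_dvd_sub_one g
  have ha := four_dvd_sub_one' g
  have hc' : g.1.1 1 0 = 0 := hc
  rw [hc', mul_zero, sub_zero] at hdet
  change (4 : ℤ) ∣ g.1.1 1 1 - 1 at hd
  change (4 : ℤ) ∣ g.1.1 0 0 - 1 at ha
  have had : g.1.1 0 0 = 1 ∧ g.1.1 1 1 = 1 := by
    rcases Int.eq_one_or_neg_one_of_mul_eq_one' hdet.symm with h | h <;> omega
  have key : ∀ (g' : CongruenceSubgroup.Gamma1 4) (n : ℕ),
      g'.1.1 = !![1, (n : ℤ); 0, 1] → g' = genT ^ n := fun g' n h =>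
    Subtype.ext (Subtype.ext (h.trans (genT_pow_apply n).symm))
  rcases Int.eq_nat_or_neg (g.1.1 0 1) with ⟨n, hn | hn⟩
  · refine ⟨n, ?_⟩
    rw [zpow_natCast]
    refine key g n ?_
    rw [Matrix.eta_fin_two g.1.1, had.1, had.2, hc', hn]
  · refine ⟨-n, ?_⟩
    rw [zpow_neg, zpow_natCast, eq_inv_iff_mul_eq_one]
    refine Subtype.ext (Subtype.ext ?_)
    change g.1.1 * (genT ^ n).1.1 = 1
    rw [genT_pow_apply, Matrix.eta_fin_two g.1.1, had.1, had.2, hc', hn]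
    simp [Matrix.one_fin_two]

/-- Euclidean descent on |c| + |d| for the bottom row (c, d): T^±1 changes d by ±c, and U^±1 changes
c by ±4d. -/
theorem closure_genT_genU : Subgroup.closure {genT, genU} = ⊤ := by
  rw [eq_top_iff]
  have hT : genT ∈ Subgroup.closure {genT, genU} := Subgroup.subset_closure (by simp)
  have hU : genU ∈ Subgroup.closure {genT, genU} := Subgroup.subset_closure (by simp)
  have key : ∀ (n : ℕ) (g : CongruenceSubgroup.Gamma1 4),
      (g.1 1 0).natAbs + (g.1 1 1).natAbs = n → g ∈ Subgroup.closure {genT, genU} := by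
    intro n
    induction n using Nat.strong_induction_on with
    | _ n ih =>
      intro g hg
      rcases eq_or_ne (g.1 1 0) 0 with hc | hc
      · obtain ⟨m, rfl⟩ := exists_eq_genT_zpow hc
        exact Subgroup.zpow_mem _ hT m
      · have h4 := four_dvd g
        have h1 := four_dvd_sub_one g
        obtain ⟨t1, t2⟩ := mul_genT_bottom g
        obtain ⟨t3, t4⟩ := mul_genT_inv_bottom g
        obtain ⟨u1, u2⟩ := mul_genU_bottom g
        obtain ⟨u3, u4⟩ := mul_genU_inv_bottom g
        have cases : ((g * genT).1 1 0).natAbs + ((g * genT).1 1 1).natAbs < n ∨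
            ((g * genT⁻¹).1 1 0).natAbs + ((g * genT⁻¹).1 1 1).natAbs < n ∨
            ((g * genU).1 1 0).natAbs + ((g * genU).1 1 1).natAbs < n ∨
            ((g * genU⁻¹).1 1 0).natAbs + ((g * genU⁻¹).1 1 1).natAbs < n := by
          rw [t1, t2, t3, t4, u1, u2, u3, u4]
          -- |c| = 2|d| is impossible, as 4 ∣ c and d is odd. If |c| < 2|d|, one of d ± c is smaller
          -- than d in absolute value; if |c| > 2|d|, one of c ± 4d is smaller than c.
          omega
        rcases cases with h | h | h | h
        · exact (Subgroup.mul_mem_cancel_right _ hT).1 (ih _ h _ rfl)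
        · exact (Subgroup.mul_mem_cancel_right _ (inv_mem hT)).1 (ih _ h _ rfl)
        · exact (Subgroup.mul_mem_cancel_right _ hU).1 (ih _ h _ rfl)
        · exact (Subgroup.mul_mem_cancel_right _ (inv_mem hU)).1 (ih _ h _ rfl)
  exact fun g _ => key _ g rfl

/-! ### Signs of complex square roots -/

theorem sqrt_sq (z : ℂ) : Complex.sqrt z ^ 2 = z := by
  rw [Complex.sqrt]
  exact_mod_cast Complex.cpow_nat_inv_pow z two_ne_zero

theorem sqrt_re_nonneg (z : ℂ) : 0 ≤ (Complex.sqrt z).re := by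
  rw [Complex.sqrt, Complex.cpow_inv_two_re]
  positivity

theorem sqrt_re_pos {z : ℂ} (hz : z.im ≠ 0) : 0 < (Complex.sqrt z).re := by
  rw [Complex.sqrt, Complex.cpow_inv_two_re]
  have := neg_lt_of_abs_lt (Complex.abs_re_lt_norm.2 hz)
  exact Real.sqrt_pos.2 (by linarith)

theorem sqrt_im_nonneg {z : ℂ} (hz : 0 ≤ z.im) : 0 ≤ (Complex.sqrt z).im := by
  rw [Complex.sqrt, Complex.cpow_inv_two_im_eq_sqrt hz]
  positivity

theorem sqrt_im_pos {z : ℂ} (hz : 0 < z.im) : 0 < (Complex.sqrt z).im := by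
  rw [Complex.sqrt, Complex.cpow_inv_two_im_eq_sqrt hz.le]
  have := lt_of_abs_lt (Complex.abs_re_lt_norm.2 hz.ne')
  exact Real.sqrt_pos.2 (by linarith)

theorem sqrt_im_neg {z : ℂ} (hz : z.im < 0) : (Complex.sqrt z).im < 0 := by
  rw [Complex.sqrt, Complex.cpow_inv_two_im_eq_neg_sqrt hz]
  have := lt_of_abs_lt (Complex.abs_re_lt_norm.2 hz.ne)
  exact neg_neg_of_pos (Real.sqrt_pos.2 (by linarith))

theorem sqrt_mul_eq_or (z w : ℂ) :
    Complex.sqrt (z * w) = Complex.sqrt z * Complex.sqrt w ∨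
      Complex.sqrt (z * w) = -(Complex.sqrt z * Complex.sqrt w) := by
  rw [← sq_eq_sq_iff_eq_or_eq_neg, mul_pow, sqrt_sq, sqrt_sq, sqrt_sq]

/-- The roots lie in the open fourth and first quadrants, so their product has positive real part,
as a principal root requires. -/
theorem sqrt_mul_of_im_neg_im_pos {z w : ℂ} (hz : z.im < 0) (hw : 0 < w.im) :
    Complex.sqrt (z * w) = Complex.sqrt z * Complex.sqrt w := by
  refine (sqrt_mul_eq_or z w).resolve_right fun h => ?_
  have h1 := congrArg Complex.re h
  rw [Complex.neg_re, Complex.mul_re] at h1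
  nlinarith [sqrt_re_nonneg (z * w), mul_pos (sqrt_re_pos hz.ne) (sqrt_re_pos hw.ne'),
    mul_pos_of_neg_of_neg (sqrt_im_neg hz) (neg_neg_of_pos (sqrt_im_pos hw))]

theorem sqrt_mul_of_im_pos_im_pos {z w : ℂ} (hz : 0 < z.im) (hw : 0 < w.im)
    (hzw : 0 ≤ (z * w).im) : Complex.sqrt (z * w) = Complex.sqrt z * Complex.sqrt w := by
  refine (sqrt_mul_eq_or z w).resolve_right fun h => ?_
  have h1 := congrArg Complex.im h
  rw [Complex.neg_im, Complex.mul_im] at h1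
  nlinarith [sqrt_im_nonneg hzw, mul_pos (sqrt_re_pos hz.ne') (sqrt_im_pos hw),
    mul_pos (sqrt_im_pos hz) (sqrt_re_pos hw.ne')]

theorem sqrt_mul_of_im_pos_im_pos_of_neg {z w : ℂ} (hz : 0 < z.im) (hw : 0 < w.im)
    (hzw : (z * w).im < 0) : Complex.sqrt (z * w) = -(Complex.sqrt z * Complex.sqrt w) := by
  refine (sqrt_mul_eq_or z w).resolve_left fun h => ?_
  have h1 := congrArg Complex.im h
  rw [Complex.mul_im] at h1
  nlinarith [sqrt_im_neg hzw, mul_pos (sqrt_re_pos hz.ne') (sqrt_im_pos hw),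
    mul_pos (sqrt_im_pos hz) (sqrt_re_pos hw.ne')]

/-! ### The cocycle relation for the theta multiplier on `Γ₁(4)` -/

theorem thetaMult_eq (g : CongruenceSubgroup.Gamma1 4) (τ : ℍ) :
    thetaMult g.1 τ = (extSymbol (g.1 1 0) (g.1 1 1) : ℂ) *
      Complex.sqrt ((g.1 1 0 : ℂ) * (τ : ℂ) + (g.1 1 1 : ℂ)) := by
  have h := four_dvd_sub_one g
  rw [thetaMult, eps, if_pos (by omega), inv_one, one_mul]

theorem isCoprime_bottom (g : CongruenceSubgroup.Gamma1 4) : IsCoprime (g.1 1 0) (g.1 1 1) := by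
  have hdet := Matrix.det_fin_two g.1.1
  rw [g.1.2] at hdet
  exact ⟨-g.1.1 0 1, g.1.1 0 0, by linear_combination -hdet⟩

theorem coe_genT_smul (τ : ℍ) : ((genT.1 • τ : ℍ) : ℂ) = τ + 1 := by
  rw [UpperHalfPlane.specialLinearGroup_apply]
  simp [genT]

theorem coe_genU_smul (τ : ℍ) : ((genU.1 • τ : ℍ) : ℂ) = τ / (4 * τ + 1) := by
  rw [UpperHalfPlane.specialLinearGroup_apply]
  simp [genU]

theorem four_mul_add_one_im_pos (τ : ℍ) : 0 < (4 * (τ : ℂ) + 1).im := by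
  simpa using τ.im_pos

theorem four_mul_add_one_ne_zero (τ : ℍ) : 4 * (τ : ℂ) + 1 ≠ 0 := fun h => by
  simpa [h] using four_mul_add_one_im_pos τ

theorem thetaMult_genT (τ : ℍ) : thetaMult genT.1 τ = 1 := by
  rw [thetaMult_eq]
  change ((extSymbol 0 1 : ℤ) : ℂ) * Complex.sqrt (((0 : ℤ) : ℂ) * τ + ((1 : ℤ) : ℂ)) = 1
  simp [extSymbol]

theorem thetaMult_genU (τ : ℍ) : thetaMult genU.1 τ = Complex.sqrt (4 * τ + 1) := by
  rw [thetaMult_eq]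
  change ((extSymbol 4 1 : ℤ) : ℂ) * Complex.sqrt (((4 : ℤ) : ℂ) * τ + ((1 : ℤ) : ℂ)) = _
  simp [extSymbol]

theorem thetaMult_mul_genT (g : CongruenceSubgroup.Gamma1 4) (τ : ℍ) :
    thetaMult (g * genT).1 τ = thetaMult g.1 (genT.1 • τ) * thetaMult genT.1 τ := by
  rw [thetaMult_genT, mul_one, thetaMult_eq, thetaMult_eq, coe_genT_smul, (mul_genT_bottom g).1,
    (mul_genT_bottom g).2, extSymbol_add_self (four_dvd g) (isCoprime_bottom g)]
  push_cast
  ring_nf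

/-- For `c ≠ 0` and `c + 4 e ≠ 0`, the symbol `(c/e)` depends on `c` modulo `4 e` up to the
sign change for negative `e`. -/
theorem extSymbol_add_mul {c d : ℤ} (hc : c ≠ 0) (hc' : c + 4 * d ≠ 0) :
    extSymbol (c + 4 * d) d =
      (if d < 0 then c.sign * (c + 4 * d).sign else 1) * extSymbol c d := by
  have hJ : jacobiSym (c + 4 * d) d.natAbs = jacobiSym c d.natAbs := by
    refine jacobiSym.mod_left' (Int.modEq_iff_dvd.2 ?_)
    rw [sub_add_cancel_left, dvd_neg]
    exact (Int.natAbs_dvd.2 dvd_rfl).mul_left 4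
  simp only [extSymbol, hc, hc', if_false, hJ]
  split_ifs with h
  · have hs : c.sign * c.sign = 1 := by
      rw [← Int.sign_mul, Int.sign_eq_one_of_pos (mul_self_pos.2 hc)]
    linear_combination (-(c + 4 * d).sign * jacobiSym c d.natAbs) * hs
  · rw [one_mul]

/-- The two sources of sign cancel: the principal root fails to be multiplicative exactly when c > 0
and c + 4d < 0, which is when the extended symbol changes sign. -/
theorem thetaMult_mul_genU (g : CongruenceSubgroup.Gamma1 4) (τ : ℍ) :
    thetaMult (g * genU).1 τ = thetaMult g.1 (genU.1 • τ) * thetaMult genU.1 τ := by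
  rw [thetaMult_genU, thetaMult_eq, thetaMult_eq, (mul_genU_bottom g).1, (mul_genU_bottom g).2]
  have h4 := four_dvd g
  have h1 := four_dvd_sub_one g
  have hcop := isCoprime_bottom g
  generalize g.1 1 0 = c at *
  generalize g.1 1 1 = d at *
  have hv := four_mul_add_one_im_pos τ
  have hUim := (genU.1 • τ).im_pos
  have hτim := τ.im_pos
  have hprod : ((c + 4 * d : ℤ) : ℂ) * (τ : ℂ) + d =
      (c * ((genU.1 • τ : ℍ) : ℂ) + d) * (4 * τ + 1) := by
    rw [coe_genU_smul]
    have := four_mul_add_one_ne_zero τ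
    push_cast
    field_simp
    ring
  have hpim : (((c + 4 * d : ℤ) : ℂ) * (τ : ℂ) + d).im = ((c + 4 * d : ℤ) : ℝ) * τ.im := by
    simp
  have hwim : ((c : ℂ) * ((genU.1 • τ : ℍ) : ℂ) + d).im = (c : ℝ) * (genU.1 • τ).im := by
    simp
  rw [hprod] at hpim ⊢
  rcases lt_trichotomy c 0 with hc | rfl | hc
  · have hw : ((c : ℂ) * ((genU.1 • τ : ℍ) : ℂ) + d).im < 0 := by
      rw [hwim]
      exact mul_neg_of_neg_of_pos (by exact_mod_cast hc) hUim
    rw [sqrt_mul_of_im_neg_im_pos hw hv, ← mul_assoc]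
    congr 3
    rcases eq_or_ne (c + 4 * d) 0 with h0 | h0
    -- Coprimality forces d = ±1, and d ≡ 1 mod 4 excludes -1; here c = -4 and both symbols equal 1.
    · have hd : d = 1 := by
        have hdc : IsUnit d := hcop.isUnit_of_dvd' ⟨-4, by linarith⟩ dvd_rfl
        rcases Int.isUnit_iff.1 hdc with h | h <;> omega
      simp [hd, extSymbol, hc.ne]
    · rw [extSymbol_add_mul hc.ne h0]
      split_ifs with hd
      · rw [Int.sign_eq_neg_one_of_neg hc, Int.sign_eq_neg_one_of_neg (by omega)]
        ring
      · rw [one_mul]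
  · have hd : d = 1 := by
      rw [isCoprime_zero_left, Int.isUnit_iff] at hcop
      omega
    simp [hd, extSymbol]
  · have hw : 0 < ((c : ℂ) * ((genU.1 • τ : ℍ) : ℂ) + d).im := by
      rw [hwim]
      exact mul_pos (by exact_mod_cast hc) hUim
    have h0 : c + 4 * d ≠ 0 := fun h0 => by
      have hdc : IsUnit d := hcop.isUnit_of_dvd' ⟨-4, by linarith⟩ dvd_rfl
      rcases Int.isUnit_iff.1 hdc with h | h <;> omega
    rw [extSymbol_add_mul hc.ne' h0, Int.sign_eq_one_of_pos hc, one_mul]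
    rcases lt_or_gt_of_ne h0 with hneg | hpos
    · have hp : (((c : ℂ) * ((genU.1 • τ : ℍ) : ℂ) + d) * (4 * τ + 1)).im < 0 := by
        rw [hpim]
        exact mul_neg_of_neg_of_pos (by exact_mod_cast hneg) hτim
      rw [sqrt_mul_of_im_pos_im_pos_of_neg hw hv hp, if_pos (by omega),
        Int.sign_eq_neg_one_of_neg hneg]
      push_cast
      ring
    · have hp : 0 ≤ (((c : ℂ) * ((genU.1 • τ : ℍ) : ℂ) + d) * (4 * τ + 1)).im := by
        rw [hpim]
        exact mul_nonneg (by exact_mod_cast hpos.le) hτim.le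
      rw [sqrt_mul_of_im_pos_im_pos hw hv hp, Int.sign_eq_one_of_pos hpos, ite_self]
      push_cast
      ring

theorem thetaMult_one (τ : ℍ) : thetaMult (1 : CongruenceSubgroup.Gamma1 4).1 τ = 1 := by
  rw [thetaMult_eq]
  change ((extSymbol 0 1 : ℤ) : ℂ) * Complex.sqrt (((0 : ℤ) : ℂ) * τ + ((1 : ℤ) : ℂ)) = 1
  simp [extSymbol]

theorem thetaMult_mul (g k : CongruenceSubgroup.Gamma1 4) (τ : ℍ) :
    thetaMult (g * k).1 τ = thetaMult g.1 (k.1 • τ) * thetaMult k.1 τ := by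
  -- The elements k for which the relation holds for all g and τ form a subgroup.
  have hk : k ∈ Subgroup.closure {genT, genU} := closure_genT_genU ▸ Subgroup.mem_top k
  induction hk using Subgroup.closure_induction generalizing g τ with
  | mem k hk =>
    rcases hk with rfl | rfl
    · exact thetaMult_mul_genT g τ
    · exact thetaMult_mul_genU g τ
  | one => rw [mul_one, thetaMult_one, mul_one]; simp
  | mul k k' _ _ ih ih' =>
    rw [← mul_assoc, ih', ih, ih' k, Subgroup.coe_mul, mul_smul, mul_assoc]
  | inv k _ ih =>
    have h1 := ih (g * k⁻¹) (k⁻¹.1 • τ)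
    have h2 := ih k⁻¹ (k⁻¹.1 • τ)
    rw [inv_mul_cancel, thetaMult_one] at h2
    rw [inv_mul_cancel_right] at h1
    have h3 : k.1 • k⁻¹.1 • τ = τ := by
      rw [← mul_smul, ← Subgroup.coe_mul, mul_inv_cancel, Subgroup.coe_one, one_smul]
    rw [h3] at h1 h2
    rw [h1, mul_assoc, mul_comm (thetaMult k.1 _), ← h2, mul_one]

/-! ### The weight `m / 2` operators form a left action -/

theorem slashHalf_one (m : ℤ) (ψ : ℍ → ℂ) : slashHalf m 1 ψ = ψ := by
  funext τ
  rw [slashHalf, inv_one, thetaMult_one, one_zpow, one_mul, Subgroup.coe_one, one_smul]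

theorem slashHalf_mul (m : ℤ) (g k : CongruenceSubgroup.Gamma1 4) (ψ : ℍ → ℂ) :
    slashHalf m (g * k) ψ = slashHalf m g (slashHalf m k ψ) := by
  funext τ
  simp only [slashHalf]
  rw [mul_inv_rev, thetaMult_mul, mul_zpow, Subgroup.coe_mul, mul_smul]
  ring

/-! ### One-variable theta functions -/

theorem exp_pi_mul_val (a : ZMod 2) (n : ℤ) :
    Complex.exp (Real.pi * Complex.I * n * a.val) = (-1) ^ (a.val * ((n : ZMod 2)).val) := by
  have key : Complex.exp (Real.pi * Complex.I * n) = (-1) ^ ((n : ZMod 2)).val := by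
    rw [mul_comm, Complex.exp_int_mul, Complex.exp_pi_mul_I]
    rcases Int.even_or_odd n with h | h
    · rw [h.neg_one_zpow, (ZMod.intCast_eq_zero_iff_even).2 h]
      rfl
    · rw [h.neg_one_zpow, (ZMod.intCast_eq_one_iff_odd).2 h]
      exact (pow_one _).symm
  rw [mul_comm, Complex.exp_nat_mul, key, ← pow_mul, mul_comm]

theorem sqrt_im_abs_lt_re {z : ℂ} (hz : 0 < z.re) :
    |(Complex.sqrt z).im| < (Complex.sqrt z).re := by
  have h := congrArg Complex.re (sqrt_sq z)
  rw [pow_two, Complex.mul_re] at h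
  exact abs_lt_of_sq_lt_sq (by nlinarith) (sqrt_re_nonneg z)

/-- The roots of w and zw have argument in (-π/4, π/4) and that of z in (0, π/2), so Re + Im is
positive for both candidate roots of zw, which excludes the minus sign. -/
theorem sqrt_mul_of_im_pos_re_pos {z w : ℂ} (hz : 0 < z.im) (hw : 0 < w.re)
    (hzw : 0 < (z * w).re) : Complex.sqrt (z * w) = Complex.sqrt z * Complex.sqrt w := by
  refine (sqrt_mul_eq_or z w).resolve_right fun h => ?_
  have h1 := congrArg Complex.re h
  have h2 := congrArg Complex.im h
  rw [Complex.neg_re, Complex.mul_re] at h1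
  rw [Complex.neg_im, Complex.mul_im] at h2
  obtain ⟨h3, h4⟩ := abs_lt.1 (sqrt_im_abs_lt_re hw)
  obtain ⟨h5, h6⟩ := abs_lt.1 (sqrt_im_abs_lt_re hzw)
  nlinarith [mul_pos (sqrt_re_pos hz.ne') (neg_lt_iff_pos_add.1 h3),
    mul_pos (sqrt_im_pos hz) (sub_pos.2 h4)]

/-- With σ = Uτ one has -1/(2τ) = -1/(2σ) + 2. Thus after the functional equation on both sides,
only periodicity and the prefactors remain. -/
theorem jacobiTheta₂_genU_smul (a : ZMod 2) (τ : ℍ) :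
    jacobiTheta₂ ((a.val : ℂ) / 2) (2 * ((genU.1 • τ : ℍ) : ℂ)) =
      (-Complex.I) ^ a.val * Complex.sqrt (4 * τ + 1) *
        jacobiTheta₂ ((a.val : ℂ) / 2) (2 * τ) := by
  have hτ := UpperHalfPlane.ne_zero τ
  have hv := four_mul_add_one_ne_zero τ
  have hUτ := UpperHalfPlane.ne_zero (genU.1 • τ)
  have hre : ∀ σ : ℍ, 0 < (-Complex.I * (2 * (σ : ℂ))).re := fun σ => by
    simpa using σ.im_pos
  have hU := coe_genU_smul τ
  have hprod : -Complex.I * (2 * (τ : ℂ)) =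
      (4 * τ + 1) * (-Complex.I * (2 * ((genU.1 • τ : ℍ) : ℂ))) := by
    rw [hU]
    linear_combination (Complex.I * 2) * mul_div_cancel₀ (τ : ℂ) hv
  have hsqrt := sqrt_mul_of_im_pos_re_pos (four_mul_add_one_im_pos τ) (hre (genU.1 • τ))
    (hprod ▸ hre τ)
  rw [← hprod] at hsqrt
  have hne : Complex.sqrt (-Complex.I * (2 * (τ : ℂ))) ≠ 0 := fun h => by
    have := sqrt_im_abs_lt_re (hre τ)
    rw [h] at this
    simp at this
  rw [jacobiTheta₂_functional_equation _ (2 * ((genU.1 • τ : ℍ) : ℂ)),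
    jacobiTheta₂_functional_equation _ (2 * (τ : ℂ)), one_div (2 : ℂ)]
  change 1 / Complex.sqrt _ * _ * _ = _ * (1 / Complex.sqrt _ * _ * _)
  have hexp : Complex.exp (-Real.pi * Complex.I * ((a.val : ℂ) / 2) ^ 2 /
      (2 * ((genU.1 • τ : ℍ) : ℂ))) = (-Complex.I) ^ a.val *
        Complex.exp (-Real.pi * Complex.I * ((a.val : ℂ) / 2) ^ 2 / (2 * (τ : ℂ))) := by
    have hI : Complex.exp (-(Real.pi / 2 * Complex.I)) = -Complex.I := by
      rw [Complex.exp_neg, Complex.exp_pi_div_two_mul_I, Complex.inv_I]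
    -- The Gaussian prefactors differ by exp(-πi a²/2), which is (-i)^a because a is 0 or 1.
    have hsq : (a.val : ℂ) ^ 2 = a.val := by
      fin_cases a <;> simp [ZMod.val]
    rw [← hI, ← Complex.exp_nat_mul, ← Complex.exp_add, div_pow, hsq, hU]
    congr 1
    field_simp
    ring
  have hth : jacobiTheta₂ ((a.val : ℂ) / 2 / (2 * ((genU.1 • τ : ℍ) : ℂ)))
      (-1 / (2 * ((genU.1 • τ : ℍ) : ℂ))) =
        jacobiTheta₂ ((a.val : ℂ) / 2 / (2 * (τ : ℂ))) (-1 / (2 * (τ : ℂ))) := by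
    have h1 : -1 / (2 * (τ : ℂ)) = -1 / (2 * ((genU.1 • τ : ℍ) : ℂ)) + 2 := by
      rw [hU]
      field_simp
      ring
    have h2 : (a.val : ℂ) / 2 / (2 * ((genU.1 • τ : ℍ) : ℂ)) =
        (a.val : ℂ) / 2 / (2 * (τ : ℂ)) + a.val := by
      rw [hU]
      field_simp
      ring
    rw [h1, jacobiTheta₂_add_right, h2]
    fin_cases a
    · simp [ZMod.val]
    · simpa [ZMod.val] using jacobiTheta₂_add_left _ _
  rw [hexp, hth, hsqrt]
  rw [hsqrt] at hne
  have hA := left_ne_zero_of_mul hne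
  have hB := right_ne_zero_of_mul hne
  generalize Complex.sqrt (-Complex.I * (2 * ((genU.1 • τ : ℍ) : ℂ))) = B at *
  generalize Complex.sqrt (4 * (τ : ℂ) + 1) = A at *
  generalize jacobiTheta₂ _ _ = J
  field_simp

/-! ### Products of series over `ℤ^d` -/

theorem hasSum_pi_prod {d : ℕ} (u : Fin d → ℤ → ℂ) (hu : ∀ i, Summable fun n => ‖u i n‖) :
    (Summable fun x : Fin d → ℤ => ‖∏ i, u i (x i)‖) ∧
      ∑' x : Fin d → ℤ, ∏ i, u i (x i) = ∏ i, ∑' n, u i n := by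
  induction d with
  | zero => exact ⟨(hasSum_fintype _).summable, by simp⟩
  | succ d ih =>
    obtain ⟨ih1, ih2⟩ := ih (fun i => u i.succ) fun i => hu i.succ
    constructor
    · rw [← (Fin.consEquiv (fun _ : Fin (d + 1) => ℤ)).summable_iff]
      refine ((hu 0).mul_norm ih1).congr fun p => ?_
      simp [Fin.prod_univ_succ, Fin.consEquiv]
    · rw [← (Fin.consEquiv (fun _ : Fin (d + 1) => ℤ)).tsum_eq, Fin.prod_univ_succ, ← ih2,
        tsum_mul_tsum_of_summable_norm (hu 0) ih1]
      refine tsum_congr fun p => ?_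
      simp [Fin.prod_univ_succ, Fin.consEquiv]

/-! ### The characters of `(ℤ/2)^d` and their theta functions -/

variable {d : ℕ}

/-- The character `x ↦ (-1)^(χ·x)` of `(ℤ/2)^d`. -/
def signChar (χ x : Fin d → ZMod 2) : ℂ := ∏ i, (-1) ^ ((χ i).val * (x i).val)

/-- The number of nonzero coordinates of `χ ∈ (ℤ/2)^d`. -/
def weight (χ : Fin d → ZMod 2) : ℕ := ∑ i, (χ i).val

theorem theta_signChar (χ : Fin d → ZMod 2) (τ : ℍ) :
    theta (signChar χ) τ = ∏ i, jacobiTheta₂ (((χ i).val : ℂ) / 2) (2 * τ) := by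
  have h2 : 0 < (2 * (τ : ℂ)).im := by
    simpa using τ.im_pos
  have := (hasSum_pi_prod (fun i n => jacobiTheta₂_term n (((χ i).val : ℂ) / 2) (2 * τ))
    fun i => ((summable_jacobiTheta₂_term_iff _ _).2 h2).norm).2
  rw [theta]
  refine Eq.trans (tsum_congr fun x => ?_) this
  simp only [thetaTerm, signChar, jacobiTheta₂_term, Complex.exp_add, Finset.prod_mul_distrib]
  congr 1
  · refine Finset.prod_congr rfl fun i _ => ?_
    rw [reduce, ← exp_pi_mul_val]
    congr 1
    ring
  · rw [← Complex.exp_sum]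
    congr 1
    simp only [quad, Int.cast_sum, Int.cast_pow, Finset.mul_sum, Finset.sum_mul]
    exact Finset.sum_congr rfl fun i _ => by ring

theorem theta_signChar_genU_smul (χ : Fin d → ZMod 2) (τ : ℍ) :
    theta (signChar χ) (genU.1 • τ) =
      (-Complex.I) ^ weight χ * Complex.sqrt (4 * τ + 1) ^ d * theta (signChar χ) τ := by
  rw [theta_signChar, theta_signChar]
  simp only [jacobiTheta₂_genU_smul, Finset.prod_mul_distrib, Finset.prod_const, Finset.card_univ,
    Fintype.card_fin, weight, Finset.prod_pow_eq_pow_sum]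

/-- Orthogonality of characters: the sum factors over the coordinates, each giving 2 or 0. -/
theorem sum_signChar_mul (x y : Fin d → ZMod 2) :
    ∑ χ, signChar χ x * signChar χ y = if x = y then 2 ^ d else 0 := by
  have h1 : ∀ s t : ZMod 2, ∑ a : ZMod 2, ((-1 : ℂ) ^ (a.val * s.val) * (-1) ^ (a.val * t.val)) =
      if s = t then 2 else 0 := by
    have h01 : ∀ s : ZMod 2, s = 0 ∨ s = 1 := by decide
    intro s t
    have hsum : ∀ F : ZMod 2 → ℂ, ∑ a, F a = F 0 + F 1 := fun F => Fin.sum_univ_two F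
    rw [hsum]
    rcases h01 s with rfl | rfl <;> rcases h01 t with rfl | rfl <;>
      simp [ZMod.val_zero, ZMod.val_one] <;> norm_num
  simp only [signChar, ← Finset.prod_mul_distrib]
  rw [← Fintype.prod_sum fun (i : Fin d) (a : ZMod 2) =>
    ((-1 : ℂ) ^ (a.val * (x i).val) * (-1) ^ (a.val * (y i).val))]
  simp only [h1]
  split_ifs with h
  · simp [h]
  · obtain ⟨i, hi⟩ := Function.ne_iff.1 h
    exact Finset.prod_eq_zero (Finset.mem_univ i) (if_neg hi)

theorem signChar_comm (χ x : Fin d → ZMod 2) : signChar χ x = signChar x χ := by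
  simp only [signChar, mul_comm]

theorem sum_sum_mul_signChar (u : (Fin d → ZMod 2) → ℂ) (x : Fin d → ZMod 2) :
    ∑ χ, (∑ ψ, u ψ * signChar ψ χ) * signChar χ x = 2 ^ d * u x := by
  have h : ∀ χ, (∑ ψ, u ψ * signChar ψ χ) * signChar χ x =
      ∑ ψ, u ψ * (signChar χ ψ * signChar χ x) := fun χ => by
    rw [Finset.sum_mul]
    exact Finset.sum_congr rfl fun ψ _ => by rw [signChar_comm ψ χ, mul_assoc]
  rw [Finset.sum_congr rfl fun χ _ => h χ, Finset.sum_comm]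
  simp only [← Finset.mul_sum, sum_signChar_mul, mul_ite, mul_zero]
  rw [Finset.sum_ite_eq' Finset.univ x, if_pos (Finset.mem_univ x), mul_comm]

/-- The finite Fourier transform, as an isomorphism onto the space of even functions. -/
def fourier (d : ℕ) : ((Fin d → ZMod 2) → ℂ) ≃ₗ[ℂ] evenFunctions 2 d where
  toFun u := ⟨fun x => ∑ χ, u χ * signChar χ x, fun x => by
    rw [show -x = x from funext fun i => ZMod.neg_eq_self_mod_two _]⟩
  map_add' u v := Subtype.ext <| funext fun x => by
    simp [add_mul, Finset.sum_add_distrib]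
  map_smul' c u := Subtype.ext <| funext fun x => by
    simp [mul_assoc, Finset.mul_sum]
  invFun f := fun χ => (2 ^ d)⁻¹ * ∑ x, f.1 x * signChar x χ
  left_inv u := funext fun χ => by
    change (2 ^ d)⁻¹ * ∑ x, (∑ ψ, u ψ * signChar ψ x) * signChar x χ = u χ
    rw [sum_sum_mul_signChar, inv_mul_cancel_left₀ (pow_ne_zero d two_ne_zero)]
  right_inv f := Subtype.ext <| funext fun x => by
    change ∑ χ, ((2 ^ d)⁻¹ * ∑ y, f.1 y * signChar y χ) * signChar χ x = f.1 x
    simp only [mul_assoc, ← Finset.mul_sum]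
    rw [sum_sum_mul_signChar, inv_mul_cancel_left₀ (pow_ne_zero d two_ne_zero)]

theorem theta_fourier (u : (Fin d → ZMod 2) → ℂ) (τ : ℍ) :
    theta (fourier d u : (Fin d → ZMod 2) → ℂ) τ = ∑ χ, u χ * theta (signChar χ) τ := by
  simp only [theta, ← tsum_mul_left]
  rw [← Summable.tsum_finsetSum fun χ _ => (summable_thetaTerm (signChar χ) τ).mul_left (u χ)]
  refine tsum_congr fun x => ?_
  change (∑ χ, u χ * signChar χ (reduce 2 x)) * _ = _
  rw [Finset.sum_mul]
  exact Finset.sum_congr rfl fun χ _ => mul_assoc _ _ _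

/-! ### The representation of `U₄` -/

/-- The additive character `j ↦ (-i)^j` of `ℤ/4`. -/
def quarticChar : AddChar (ZMod 4) ℂ :=
  AddChar.zmodChar 4 (ζ := -Complex.I) (by
    rw [neg_pow, Complex.I_pow_four]
    norm_num)

/-- The powers of `quarticChar` with exponents the weights, as functions on `(ℤ/2)^d`. -/
def weightChar (d : ℕ) : Multiplicative (ZMod 4) →* ((Fin d → ZMod 2) → ℂ) :=
  MonoidHom.pi fun χ => (powMonoidHom (weight χ)).comp quarticChar.toMonoidHom

/-- The representation of `U₄` for which the character `χ` has eigenvalue `(-i)^(j * weight χ)`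
under `[1, j; 0, 1]`. -/
def repU4 (d : ℕ) : U4 →* LinearMap.GeneralLinearGroup ℂ (evenFunctions 2 d) :=
  MonoidHom.toHomUnits <|
    (MonoidHomClass.toMonoidHom ((fourier d).conjAlgEquiv ℂ)).comp <|
      (MonoidHomClass.toMonoidHom (Algebra.lmul ℂ ((Fin d → ZMod 2) → ℂ))).comp <|
        (weightChar d).comp U4Equiv.symm.toMonoidHom

theorem repU4_apply_fourier (j : ZMod 4) (u : (Fin d → ZMod 2) → ℂ) :
    (repU4 d (U4Equiv (Multiplicative.ofAdd j)) :
      evenFunctions 2 d →ₗ[ℂ] evenFunctions 2 d) (fourier d u) =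
        fourier d (fun χ => quarticChar j ^ weight χ * u χ) := by
  change fourier d (weightChar d (U4Equiv.symm (U4Equiv (Multiplicative.ofAdd j))) *
    (fourier d).symm (fourier d u)) = _
  rw [MulEquiv.symm_apply_apply, LinearEquiv.symm_apply_apply]
  rfl

/-! ### The intertwining relation on generators -/

theorem theta_genT_smul (f : (Fin d → ZMod 2) → ℂ) (τ : ℍ) :
    theta f (genT.1 • τ) = theta f τ := by
  refine tsum_congr fun x => ?_
  rw [thetaTerm, thetaTerm, coe_genT_smul, mul_add, Complex.exp_add, mul_one]
  rw [show 2 * Real.pi * Complex.I * (quad x : ℂ) = (quad x : ℂ) * (2 * Real.pi * Complex.I) by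
    ring, Complex.exp_int_mul_two_pi_mul_I, mul_one]

/-- The relation `[g̃]_{d/2} θ_f = θ_{ρ(ω(μ(g))) f}` for all `f`. -/
def Intertwines (d : ℕ) (g : CongruenceSubgroup.Gamma1 4) : Prop :=
  ∀ f : evenFunctions 2 d, slashHalf (d : ℤ) g (theta (f : (Fin d → ZMod 2) → ℂ)) =
    theta (((repU4 d (reduceU4 (conjGamma g)) :
      evenFunctions 2 d →ₗ[ℂ] evenFunctions 2 d) f : evenFunctions 2 d) : (Fin d → ZMod 2) → ℂ)

theorem Intertwines.one : Intertwines d 1 := fun f => by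
  rw [slashHalf_one, map_one, map_one, map_one]
  rfl

theorem Intertwines.mul {g k : CongruenceSubgroup.Gamma1 4} (hg : Intertwines d g)
    (hk : Intertwines d k) : Intertwines d (g * k) := fun f => by
  rw [slashHalf_mul, hk, hg, map_mul, map_mul, map_mul]
  rfl

theorem Intertwines.inv {g : CongruenceSubgroup.Gamma1 4} (hg : Intertwines d g) :
    Intertwines d g⁻¹ := fun f => by
  -- The relation for g is applied to π₂(g⁻¹)f, which π₂(g) sends back to f.
  have h := hg ((repU4 d (reduceU4 (conjGamma g⁻¹)) :
    evenFunctions 2 d →ₗ[ℂ] evenFunctions 2 d) f)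
  rw [← Module.End.mul_apply, ← Units.val_mul, ← map_mul, ← map_mul, ← map_mul, mul_inv_cancel,
    map_one, map_one, map_one, Units.val_one, Module.End.one_apply] at h
  rw [← h, ← slashHalf_mul, inv_mul_cancel, slashHalf_one]

theorem reduceU4_conjGamma_genT : reduceU4 (conjGamma genT) = 1 := by
  refine Subtype.ext (Subtype.ext (Matrix.ext fun i j => ?_))
  fin_cases i <;> fin_cases j <;> decide

theorem reduceU4_conjGamma_genU :
    reduceU4 (conjGamma genU) = U4Equiv (Multiplicative.ofAdd (-1)) := by
  refine Subtype.ext (Subtype.ext (Matrix.ext fun i j => ?_))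
  fin_cases i <;> fin_cases j <;> decide

theorem intertwines_genT_inv : Intertwines d genT⁻¹ := fun f => by
  rw [map_inv, map_inv, reduceU4_conjGamma_genT, inv_one, map_one]
  funext τ
  rw [slashHalf, inv_inv, thetaMult_genT, one_zpow, one_mul, theta_genT_smul]
  rfl

/-- The operator of g evaluates at g⁻¹τ, so the inverse generator is the one for which the
transformation law under U applies directly. -/
theorem intertwines_genU_inv : Intertwines d genU⁻¹ := fun f => by
  obtain ⟨u, rfl⟩ := (fourier d).surjective f
  rw [map_inv, map_inv, reduceU4_conjGamma_genU, ← map_inv, ← ofAdd_neg, neg_neg,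
    repU4_apply_fourier]
  funext τ
  have hne : Complex.sqrt (4 * (τ : ℂ) + 1) ≠ 0 := fun h => by
    have := sqrt_re_pos (four_mul_add_one_im_pos τ).ne'
    rw [h] at this
    simp at this
  have hq : quarticChar 1 = -Complex.I := pow_one _
  rw [slashHalf, inv_inv, thetaMult_genU, theta_fourier, theta_fourier, Finset.mul_sum, hq]
  refine Finset.sum_congr rfl fun χ _ => ?_
  rw [theta_signChar_genU_smul, zpow_neg, zpow_natCast]
  field_simp

theorem intertwines (d : ℕ) (g : CongruenceSubgroup.Gamma1 4) : Intertwines d g := by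
  have hg : g ∈ Subgroup.closure {genT, genU} := closure_genT_genU ▸ Subgroup.mem_top g
  induction hg using Subgroup.closure_induction with
  | mem k hk =>
    rcases hk with rfl | rfl
    · exact inv_inv genT ▸ intertwines_genT_inv.inv
    · exact inv_inv genU ▸ intertwines_genU_inv.inv
  | one => exact Intertwines.one
  | mul k k' _ _ hk hk' => exact hk.mul hk'
  | inv k _ hk => exact hk.inv

end WeightedTheta

end

theorem theorem2p10 (d : ℕ) (hd : 1 ≤ d) :
    ∃ (π₂ : CongruenceSubgroup.Gamma1 4 →*
          LinearMap.GeneralLinearGroup ℂ (WeightedTheta.evenFunctions 2 d))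
      (ρ₂ : WeightedTheta.U4 →*
          LinearMap.GeneralLinearGroup ℂ (WeightedTheta.evenFunctions 2 d)),
      π₂ = ρ₂.comp (WeightedTheta.reduceU4.comp WeightedTheta.conjGamma) ∧
      ∀ (g : CongruenceSubgroup.Gamma1 4) (f : WeightedTheta.evenFunctions 2 d),
        WeightedTheta.slashHalf (d : ℤ) g
            (WeightedTheta.theta (f : (Fin d → ZMod 2) → ℂ)) =
          WeightedTheta.theta
            ((π₂ g : WeightedTheta.evenFunctions 2 d →ₗ[ℂ] WeightedTheta.evenFunctions 2 d) f :
              (Fin d → ZMod 2) → ℂ) :=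
  ⟨_, WeightedTheta.repU4 d, rfl, WeightedTheta.intertwines d⟩
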